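/- Notation. All vector spaces are over $\mathbb{Z}_2$. For a group $H$ and an abelian group $A$, $A^{\oplus H}$ is the group of finitely supported functions $H\to A$, on which $H$ acts by coordinate right-translation, and $A\wr H:=A^{\oplus H}\rtimes H$. If $H$ has the finite symmetric generating set $T$ and $V\le\mathbb{Z}_2^{\oplus H}$ is a right-translation-invariant subspace, then $(\mathbb{Z}_2^{\oplus H}/V)\rtimes H$ is given the left-invariant word metric of the generating set $\{(\delta_{e_H}+V,e_H)\}\cup\{(0,t):t\in T\}$. For $W\le\mathbb{Z}_2^d$, $d_{\mathrm{Ham}/W}$ is the quotient of the Hamming metric on $\mathbb{Z}_2^d/W$, i.e. the least Hamming distance between elements of the two cosets. A map $f:(X,\sigma)\to(Z,\theta)$ is $M$-bi-Lipschitz if for some $r>0$ we have $r\,\sigma(u,v)\le\theta(f(u),f(v))\le M r\,\sigma(u,v)$ for all $u,v$ (i.e. its distortion is at most $M$); its expansion ratio is $\inf_{u\ne v}\theta(f(u),f(v))/\sigma(u,v)$. For each $d$ let $C_d\le\mathbb{Z}_2^d$ be a subspace containing $(1,1,\ldots,1)$, and let $V_d:=C_d^\perp\le\mathbb{Z}_2^d$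 be its dual for the standard bilinear form (for example the subspaces of Khot and Naor, for which $\mathbb{Z}_2^d/V_d$ has $L_p$-distortion $\gtrsim_p d$ for every $p\in[1,\infty)$). Theorem. Let $G$ be a finitely generated amenable group of exponential growth, with finite symmetric generating set $S$, and give $\mathbb{Z}_6\wr G$ the generating set consisting of $(\pm\mathbf{e}_{e_G},e_G)$ and the elements $(0,s)$, $s\in S$, where $\mathbf{e}_{e_G}$ is the function with value $1\in\mathbb{Z}_6$ at $e_G$ and $0$ elsewhere. Then there are a constant $M\ge1$ and a subspace $V\le\mathbb{Z}_2^{\oplus(\mathbb{Z}_6\wr G)}$, invariant under coordinate right-translation by $\mathbb{Z}_6\wr G$, together with integers $1\le d_1<d_2<\cdots$ and injections \[\varphi_n:\mathbb{Z}_2^{d_n}/V_{d_n}\hookrightarrow\mathbb{Z}_2^{\oplus(\mathbb{Z}_6\wr G)}/V\subset(\mathbb{Z}_2^{\oplus(\mathbb{Z}_6\wr G)}/V)\rtimes(\mathbb{Z}_6\wr G)\] such that every $\varphi_n$ is an $M$-bi-Lipschitz embedding of $d_{\mathrm{Ham}/V_{d_n}}$ into the word metric of $(\mathbb{Z}_2^{\oplus(\mathbb{Z}_6\wr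 G)}/V)\rtimes(\mathbb{Z}_6\wr G)$, and the expansion ratios $r_n$ of the $\varphi_n$ satisfy $r_n\le K\log d_n$ for all $n$, with a constant $K$ independent of $n$. -/

import Mathlib

noncomputable section

/-! ### Word metrics, exponential growth, amenability -/

/-- The word norm of `g` with respect to `S`: the least length of a word in the letters of `S`
that evaluates to `g` (used only for generating sets `S` closed under inversion). -/
def wordNorm {G : Type*} [Group G] (S : Set G) (g : G) : ℕ :=
  sInf {n : ℕ | ∃ l : List G, (∀ s ∈ l, s ∈ S) ∧ l.prod = g ∧ l.length = n}

/-- The left-invariant word metric. -/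
def wordDist {G : Type*} [Group G] (S : Set G) (g h : G) : ℕ :=
  wordNorm S (g⁻¹ * h)

/-- Exponential growth: the balls around the identity in the word metric of `S` have at least
`c ^ n` elements, for some `c > 1`. -/
def HasExponentialGrowth {G : Type*} [Group G] (S : Set G) : Prop :=
  ∃ c : ℝ, 1 < c ∧ ∀ n : ℕ, c ^ n ≤ ({g : G | wordDist S 1 g ≤ n}.ncard : ℝ)

/-- A discrete group is amenable if it carries a left-invariant finitely additive probability
measure defined on all of its subsets. -/
def IsAmenable (G : Type*) [Group G] : Prop :=
  ∃ m : Set G → ℝ, (∀ A, 0 ≤ m A) ∧ m Set.univ = 1 ∧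
    (∀ A B, Disjoint A B → m (A ∪ B) = m A + m B) ∧
    ∀ (g : G) (A : Set G), m ((fun x => g * x) '' A) = m A

/-! ### Bi-Lipschitz maps and expansion ratios -/

/-- `f` is an `M`-bi-Lipschitz embedding of the metric `σ` into the metric `θ`, i.e. its distortion
(the product of the suprema of `θ (f u) (f v) / σ u v` and of `σ u v / θ (f u) (f v)`) is at
most `M`. -/
def IsBiLipschitz {X Z : Type*} (M : ℝ) (σ : X → X → ℝ) (θ : Z → Z → ℝ) (f : X → Z) : Prop :=
  ∃ r : ℝ, 0 < r ∧ ∀ u v : X, r * σ u v ≤ θ (f u) (f v) ∧ θ (f u) (f v) ≤ M * r * σ u v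

/-- The expansion ratio of `f`: the infimum of `θ (f u) (f v) / σ u v` over all `u ≠ v`. -/
def expansionRatio {X Z : Type*} (σ : X → X → ℝ) (θ : Z → Z → ℝ) (f : X → Z) : ℝ :=
  ⨅ p : {p : X × X // p.1 ≠ p.2}, θ (f p.1.1) (f p.1.2) / σ p.1.1 p.1.2

/-! ### Cube quotients -/

/-- The dual `C^⊥` of a subspace `C` of the cube, for the standard bilinear form. -/
def dualCode {d : ℕ} (C : Submodule (ZMod 2) (Fin d → ZMod 2)) :
    Submodule (ZMod 2) (Fin d → ZMod 2) where
  carrier := {w | ∀ v ∈ C, ∑ i, w i * v i = 0}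
  add_mem' := by
    intro a b ha hb v hv
    simp [add_mul, Finset.sum_add_distrib, ha v hv, hb v hv]
  zero_mem' := by
    intro v _
    simp
  smul_mem' := by
    intro c a ha v hv
    simp [mul_assoc, ← Finset.mul_sum, ha v hv]

/-- The quotient of the Hamming metric: the distance between two cosets of `W` is the least
Hamming distance between their elements. -/
def hammingQuotDist {d : ℕ} (W : Submodule (ZMod 2) (Fin d → ZMod 2))
    (P Q : (Fin d → ZMod 2) ⧸ W) : ℕ :=
  sInf {k : ℕ | ∃ x y : Fin d → ZMod 2,
    Submodule.Quotient.mk x = P ∧ Submodule.Quotient.mk y = Q ∧ hammingDist x y = k}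

/-! ### The wreath product and the semidirect product over a quotient -/

/-- Coordinate right-translation on finitely supported functions: `f ↦ (x ↦ f (x * h))`. -/
def rightTranslate {H A : Type*} [Group H] [AddCommGroup A] (h : H) : (H →₀ A) ≃+ (H →₀ A) :=
  Finsupp.domCongr (Equiv.mulRight h⁻¹)

theorem rightTranslate_apply {H A : Type*} [Group H] [AddCommGroup A] (h : H) (f : H →₀ A)
    (x : H) : rightTranslate h f x = f (x * h) := by
  simp [rightTranslate, Finsupp.domCongr, Finsupp.equivMapDomain_apply]

theorem rightTranslate_one {H A : Type*} [Group H] [AddCommGroup A] (f : H →₀ A) :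
    rightTranslate (1 : H) f = f := by
  ext x
  simp [rightTranslate_apply]

theorem rightTranslate_mul {H A : Type*} [Group H] [AddCommGroup A] (g h : H) (f : H →₀ A) :
    rightTranslate (g * h) f = rightTranslate g (rightTranslate h f) := by
  ext x
  simp [rightTranslate_apply, mul_assoc]

/-- The action of `H` on `A^{⊕H}` by coordinate right-translation. -/
def lampAction (A H : Type*) [Group H] [AddCommGroup A] :
    H →* MulAut (Multiplicative (H →₀ A)) where
  toFun h := AddEquiv.toMultiplicative (rightTranslate h)
  map_one' := by
    refine MulEquiv.ext fun f => ?_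
    exact congrArg Multiplicative.ofAdd (rightTranslate_one f.toAdd)
  map_mul' g h := by
    refine MulEquiv.ext fun f => ?_
    exact congrArg Multiplicative.ofAdd (rightTranslate_mul g h f.toAdd)

/-- The (restricted) wreath product `A ≀ H = A^{⊕H} ⋊ H`, with the multiplication
`(f, g) * (f', g') = (f + f' (· * g), g * g')`. The other common convention,
`(f, g) * (f', g') = (f (· * g'⁻¹) + f', g * g')`, gives an isomorphic group through
`(f, g) ↦ (f (· * g), g)`, which is the identity on `A^{⊕H}` and on `H`. -/
abbrev WreathProduct (A H : Type*) [Group H] [AddCommGroup A] : Type _ :=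
  SemidirectProduct (Multiplicative (H →₀ A)) H (lampAction A H)

/-- The lift to `ℤ₆ ≀ G` of a generating set `S` of `G`: the two elements `±e` at the identity
coordinate, where `e` is the standard generator, together with `S`. -/
def wreathGenerators {G : Type*} [Group G] (S : Set G) : Set (WreathProduct (ZMod 6) G) :=
  {SemidirectProduct.inl (Multiplicative.ofAdd (Finsupp.single 1 1)),
    SemidirectProduct.inl (Multiplicative.ofAdd (Finsupp.single 1 (-1)))} ∪
  SemidirectProduct.inr '' S

/-- A subspace of `ℤ₂^{⊕H}` that is invariant under coordinate right-translation. -/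
def IsTranslationInvariant {H : Type*} [Group H] (V : Submodule (ZMod 2) (H →₀ ZMod 2)) : Prop :=
  ∀ (h : H), ∀ f ∈ V, rightTranslate h f ∈ V

/-- Right-translation by `h` on the quotient `ℤ₂^{⊕H} / V`. -/
def quotTranslate {H : Type*} [Group H] (V : Submodule (ZMod 2) (H →₀ ZMod 2))
    (hV : IsTranslationInvariant V) (h : H) :
    ((H →₀ ZMod 2) ⧸ V) →+ ((H →₀ ZMod 2) ⧸ V) :=
  QuotientAddGroup.map V.toAddSubgroup V.toAddSubgroup
    (rightTranslate h : (H →₀ ZMod 2) ≃+ (H →₀ ZMod 2)).toAddMonoidHom (fun f hf => hV h f hf)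

theorem quotTranslate_mk {H : Type*} [Group H] (V : Submodule (ZMod 2) (H →₀ ZMod 2))
    (hV : IsTranslationInvariant V) (h : H) (f : H →₀ ZMod 2) :
    quotTranslate V hV h (Submodule.Quotient.mk f) =
      Submodule.Quotient.mk (rightTranslate h f) := rfl

theorem quotTranslate_one {H : Type*} [Group H] (V : Submodule (ZMod 2) (H →₀ ZMod 2))
    (hV : IsTranslationInvariant V) (q : (H →₀ ZMod 2) ⧸ V) :
    quotTranslate V hV 1 q = q := by
  obtain ⟨f, rfl⟩ := Submodule.Quotient.mk_surjective V q
  rw [quotTranslate_mk, rightTranslate_one]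

theorem quotTranslate_mul {H : Type*} [Group H] (V : Submodule (ZMod 2) (H →₀ ZMod 2))
    (hV : IsTranslationInvariant V) (g h : H) (q : (H →₀ ZMod 2) ⧸ V) :
    quotTranslate V hV (g * h) q = quotTranslate V hV g (quotTranslate V hV h q) := by
  obtain ⟨f, rfl⟩ := Submodule.Quotient.mk_surjective V q
  simp only [quotTranslate_mk, rightTranslate_mul]

/-- The action of `H` on `ℤ₂^{⊕H} / V` induced by coordinate right-translation. -/
def quotLampAction {H : Type*} [Group H] (V : Submodule (ZMod 2) (H →₀ ZMod 2))
    (hV : IsTranslationInvariant V) : H →* MulAut (Multiplicative ((H →₀ ZMod 2) ⧸ V)) where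
  toFun h := AddEquiv.toMultiplicative
    { toFun := quotTranslate V hV h
      invFun := quotTranslate V hV h⁻¹
      left_inv := fun q => by rw [← quotTranslate_mul, inv_mul_cancel, quotTranslate_one]
      right_inv := fun q => by rw [← quotTranslate_mul, mul_inv_cancel, quotTranslate_one]
      map_add' := map_add _ }
  map_one' := by
    refine MulEquiv.ext fun q => ?_
    exact congrArg Multiplicative.ofAdd (quotTranslate_one V hV q.toAdd)
  map_mul' g h := by
    refine MulEquiv.ext fun q => ?_
    exact congrArg Multiplicative.ofAdd (quotTranslate_mul V hV g h q.toAdd)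

/-- The semidirect product `(ℤ₂^{⊕H} / V) ⋊ H`. -/
abbrev LampQuotient {H : Type*} [Group H] (V : Submodule (ZMod 2) (H →₀ ZMod 2))
    (hV : IsTranslationInvariant V) : Type _ :=
  SemidirectProduct (Multiplicative ((H →₀ ZMod 2) ⧸ V)) H (quotLampAction V hV)

/-- The inclusion of `ℤ₂^{⊕H} / V` as the zero section of `(ℤ₂^{⊕H} / V) ⋊ H`. -/
def zeroSection {H : Type*} [Group H] (V : Submodule (ZMod 2) (H →₀ ZMod 2))
    (hV : IsTranslationInvariant V) (q : (H →₀ ZMod 2) ⧸ V) : LampQuotient V hV :=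
  SemidirectProduct.inl (Multiplicative.ofAdd q)

/-- The generating set of `(ℤ₂^{⊕H} / V) ⋊ H` associated with a generating set `T` of `H`: the
class of the indicator function of the identity, together with `T`. -/
def lampQuotientGenerators {H : Type*} [Group H] (V : Submodule (ZMod 2) (H →₀ ZMod 2))
    (hV : IsTranslationInvariant V) (T : Set H) : Set (LampQuotient V hV) :=
  {zeroSection V hV (Submodule.Quotient.mk (Finsupp.single 1 1))} ∪ SemidirectProduct.inr '' T

end

/-! Exponential growth supplies, at every scale `R`, as many as `2 ^ R` sites in `G` that lie at
distance between `R` and `k * R` from the identity and at distance at least `R` from one another.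
The cube with `d = 2 ^ R` coordinates is placed in the lamp space by sending the basis vector `i` to
the indicator of the wreath product element whose single lit lamp is at the site `x i`. Moving
between these points costs order `R` per coordinate, and `R` is `log d / log 2`, which gives the
bound on the expansion ratio.

Two things must be checked. First, imposing all translates of the relations at all scales must not
add relations on a given cube. The linear map `readout` detects this: it sends the indicator of an
element with trivial `G`-component to the parities of its lamps at the sites, and other indicators
to zero. Since the dual codes are orthogonal to the all-ones vector, a relation has coordinate sum
zero. A translate therefore reads out as zero or exactly as the untranslated relation
(`readout_rightTranslate_of_sum_eq_zero`), and disjointness of the sites at different scales removes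
the other cubes (`readout_mem_of_mem_translateSpan`).

Second, distances must not collapse. A letter that changes the lamp function contributes the lamp
parities of the current wreath element, so the readout of a word is supported on the sites whose
lamps were toggled along the way. Reaching each new site costs at least `R` letters, by separation
(`exists_readout_support`). Hence a word representing a cube vector yields a vector in the same
coset of Hamming norm at most its length divided by `R`. -/

open SemidirectProduct

/-! ### Words of bounded length -/

/-- `g` is a product of at most `n` letters from `S`. -/
def IsShortProduct {G : Type*} [Group G] (S : Set G) (n : ℕ) (g : G) : Prop :=
  ∃ l : List G, (∀ s ∈ l, s ∈ S) ∧ l.prod = g ∧ l.length ≤ n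

namespace IsShortProduct

variable {G : Type*} [Group G] {S : Set G}

theorem one (n : ℕ) : IsShortProduct S n 1 := ⟨[], by simp, rfl, by simp⟩

theorem of_mem {s : G} (hs : s ∈ S) : IsShortProduct S 1 s :=
  ⟨[s], by simpa using hs, by simp, by simp⟩

theorem mul {m n : ℕ} {g h : G} (hg : IsShortProduct S m g) (hh : IsShortProduct S n h) :
    IsShortProduct S (m + n) (g * h) := by
  obtain ⟨l, hl, rfl, hlm⟩ := hg
  obtain ⟨l', hl', rfl, hln⟩ := hh
  refine ⟨l ++ l', ?_, by simp, by simp; omega⟩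
  intro s hs
  rcases List.mem_append.1 hs with h | h
  exacts [hl s h, hl' s h]

theorem mono {m n : ℕ} {g : G} (h : IsShortProduct S m g) (hmn : m ≤ n) :
    IsShortProduct S n g :=
  let ⟨l, hl, hg, hlm⟩ := h
  ⟨l, hl, hg, hlm.trans hmn⟩

theorem inv (hS : ∀ s ∈ S, s⁻¹ ∈ S) {n : ℕ} {g : G} (h : IsShortProduct S n g) :
    IsShortProduct S n g⁻¹ := by
  obtain ⟨l, hl, rfl, hln⟩ := h
  refine ⟨(l.map fun x => x⁻¹).reverse, ?_, (List.prod_inv_reverse l).symm, by simpa using hln⟩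
  intro s hs
  simp only [List.mem_reverse, List.mem_map] at hs
  obtain ⟨t, ht, rfl⟩ := hs
  exact hS t (hl t ht)

theorem map {H : Type*} [Group H] {T : Set H} (f : G →* H) (hf : ∀ s ∈ S, f s ∈ T) {n : ℕ} {g : G}
    (h : IsShortProduct S n g) : IsShortProduct T n (f g) := by
  obtain ⟨l, hl, rfl, hln⟩ := h
  refine ⟨l.map f, ?_, (map_list_prod f l).symm, by simpa using hln⟩
  intro s hs
  obtain ⟨t, ht, rfl⟩ := List.mem_map.1 hs
  exact hf t (hl t ht)

theorem wordNorm_le {n : ℕ} {g : G} (h : IsShortProduct S n g) : wordNorm S g ≤ n := by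
  obtain ⟨l, hl, hg, hln⟩ := h
  exact (Nat.sInf_le ⟨l, hl, hg, rfl⟩ : wordNorm S g ≤ l.length).trans hln

theorem exists_wordNorm {n : ℕ} {g : G} (h : IsShortProduct S n g) :
    IsShortProduct S (wordNorm S g) g := by
  obtain ⟨l, hl, hg, -⟩ := h
  obtain ⟨l', hl', hg', hn⟩ := Nat.sInf_mem
    (s := {n : ℕ | ∃ l : List G, (∀ s ∈ l, s ∈ S) ∧ l.prod = g ∧ l.length = n}) ⟨_, l, hl, hg, rfl⟩
  exact ⟨l', hl', hg', hn.le⟩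

end IsShortProduct

theorem isShortProduct_wordNorm {G : Type*} [Group G] {S : Set G} (hS : ∀ s ∈ S, s⁻¹ ∈ S)
    (hgen : Subgroup.closure S = ⊤) (g : G) : IsShortProduct S (wordNorm S g) g := by
  have hg : g ∈ Subgroup.closure S := hgen ▸ Subgroup.mem_top g
  suffices h : ∃ n, IsShortProduct S n g from h.choose_spec.exists_wordNorm
  induction hg using Subgroup.closure_induction with
  | mem x hx => exact ⟨1, .of_mem hx⟩
  | one => exact ⟨0, .one 0⟩
  | mul x y _ _ hx hy => exact ⟨_, hx.choose_spec.mul hy.choose_spec⟩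
  | inv x _ hx => exact ⟨_, hx.choose_spec.inv hS⟩

theorem wordNorm_one {G : Type*} [Group G] (S : Set G) : wordNorm S (1 : G) = 0 :=
  Nat.le_zero.1 (IsShortProduct.one 0).wordNorm_le

theorem wordNorm_inv {G : Type*} [Group G] {S : Set G} (hS : ∀ s ∈ S, s⁻¹ ∈ S)
    (hgen : Subgroup.closure S = ⊤) (g : G) : wordNorm S g⁻¹ = wordNorm S g := by
  apply le_antisymm
  · exact ((isShortProduct_wordNorm hS hgen g).inv hS).wordNorm_le
  · simpa using ((isShortProduct_wordNorm hS hgen g⁻¹).inv hS).wordNorm_le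

theorem wordNorm_mul_generator_le {G : Type*} [Group G] {S : Set G} (hS : ∀ s ∈ S, s⁻¹ ∈ S)
    (hgen : Subgroup.closure S = ⊤) (g : G) {s : G} (hs : s ∈ S) :
    wordNorm S (g * s) ≤ wordNorm S g + 1 :=
  ((isShortProduct_wordNorm hS hgen g).mul (.of_mem hs)).wordNorm_le

/-! ### Separated sets in groups of exponential growth -/

open scoped Pointwise in
open Classical in
theorem exists_finset_of_wordNorm_le {G : Type*} [Group G] (S : Finset G)
    (hS : ∀ s ∈ S, s⁻¹ ∈ S) (hgen : Subgroup.closure (S : Set G) = ⊤) (n : ℕ) :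
    ∃ B : Finset G, (∀ g, g ∈ B ↔ wordNorm (S : Set G) g ≤ n) ∧ B.card ≤ (S.card + 1) ^ n := by
  have key : ∀ g, wordNorm (S : Set G) g ≤ n → g ∈ (insert 1 S) ^ n := by
    intro g hg
    obtain ⟨l, hl, rfl, hn⟩ := (isShortProduct_wordNorm (S := (S : Set G)) hS hgen g).mono hg
    clear hg
    induction l generalizing n with
    | nil => exact Finset.one_mem_pow (Finset.mem_insert_self 1 S)
    | cons a l ih =>
      obtain ⟨m, rfl⟩ : ∃ m, n = m + 1 := ⟨n - 1, by simp at hn; omega⟩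
      rw [pow_succ', List.prod_cons]
      refine Finset.mul_mem_mul (Finset.mem_insert_of_mem (hl a (by simp))) (ih m ?_ ?_)
      · exact fun s hs => hl s (by simp [hs])
      · simpa using hn
  refine ⟨((insert 1 S) ^ n).filter fun g => wordNorm (S : Set G) g ≤ n, fun g => ?_, ?_⟩
  · simpa using key g
  · refine (Finset.card_filter_le _ _).trans (Finset.card_pow_le.trans ?_)
    gcongr
    exact Finset.card_insert_le 1 S

/-- Greedy choice of separated points in a large ball. -/
theorem exists_separated_finset {G : Type*} [Group G] (S : Finset G)
    (hS : ∀ s ∈ S, s⁻¹ ∈ S) (hgen : Subgroup.closure (S : Set G) = ⊤) (B : Finset G) {R t : ℕ}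
    (ht : t * (S.card + 1) ^ R < B.card) :
    ∃ Y : Finset G, Y.card = t + 1 ∧ 1 ∈ Y ∧ (∀ y ∈ Y, y = 1 ∨ y ∈ B) ∧
      ∀ a ∈ Y, ∀ b ∈ Y, a ≠ b → R ≤ wordNorm (S : Set G) (a * b⁻¹) := by
  classical
  induction t with
  | zero => exact ⟨{1}, by simp⟩
  | succ t ih =>
    obtain ⟨Y, hYc, h1, hYB, hsep⟩ := ih (lt_of_le_of_lt (by gcongr; omega) ht)
    obtain ⟨D, hD, hDc⟩ := exists_finset_of_wordNorm_le S hS hgen R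
    -- The `t + 1` points of `Y` have right translates `D * a` of the `R`-ball covering too few
    -- elements to exhaust `B`. Right translates are used because separation concerns `a * b⁻¹`.
    obtain ⟨b, hbB, hb⟩ : ∃ b ∈ B, b ∉ Y.biUnion fun a => D.image (· * a) := by
      apply Finset.exists_mem_notMem_of_card_lt_card
      refine lt_of_le_of_lt ?_ ht
      rw [← hYc]
      exact Finset.card_biUnion_le_card_mul _ _ _ fun a _ => Finset.card_image_le.trans hDc
    have hfar : ∀ a ∈ Y, R < wordNorm (S : Set G) (b * a⁻¹) := by
      intro a ha
      by_contra hle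
      exact hb (Finset.mem_biUnion.2 ⟨a, ha, Finset.mem_image.2
        ⟨b * a⁻¹, (hD _).2 (not_lt.1 hle), by simp⟩⟩)
    have hbY : b ∉ Y := fun h => by
      have := hfar b h
      rw [mul_inv_cancel, wordNorm_one] at this
      omega
    refine ⟨insert b Y, by rw [Finset.card_insert_of_notMem hbY, hYc],
      Finset.mem_insert_of_mem h1, ?_, ?_⟩
    · intro y hy
      rcases Finset.mem_insert.1 hy with rfl | hy
      exacts [Or.inr hbB, hYB y hy]
    · intro a ha c hc hac
      rcases Finset.mem_insert.1 ha with rfl | haY <;> rcases Finset.mem_insert.1 hc with rfl | hcY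
      · exact absurd rfl hac
      · exact (hfar c hcY).le
      · rw [← wordNorm_inv hS hgen, mul_inv_rev, inv_inv]
        exact (hfar a haY).le
      · exact hsep a haY c hcY hac

/-- A family of points of norm between `R` and `Q` with mutual distances at least `R`. -/
structure IsSeparatedFamily {G ι : Type*} [Group G] (S : Set G) (R Q : ℕ) (x : ι → G) : Prop where
  norm_le : ∀ i, wordNorm S (x i) ≤ Q
  le_norm : ∀ i, R ≤ wordNorm S (x i)
  le_dist : ∀ i j, i ≠ j → R ≤ wordNorm S (x i * (x j)⁻¹)

theorem IsSeparatedFamily.injective {G ι : Type*} [Group G] {S : Set G} {R Q : ℕ} {x : ι → G}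
    (h : IsSeparatedFamily S R Q x) (hR : 1 ≤ R) : Function.Injective x := by
  intro i j hij
  by_contra hne
  have := h.le_dist i j hne
  rw [hij, mul_inv_cancel, wordNorm_one] at this
  omega

/-- For suitable `k`, the ball of radius `k * R` is larger than `2 ^ R` times the bound on the
`R`-ball, so the greedy choice gives `2 ^ R + 1` points. One of them is the identity; discarding it
leaves `2 ^ R` points, all at distance at least `R` from it. -/
theorem exists_isSeparatedFamily {G : Type*} [Group G] (S : Finset G)
    (hS : ∀ s ∈ S, s⁻¹ ∈ S) (hgen : Subgroup.closure (S : Set G) = ⊤)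
    (hexp : HasExponentialGrowth (S : Set G)) :
    ∃ k : ℕ, ∀ R, 1 ≤ R →
      ∃ x : Fin (2 ^ R) → G, IsSeparatedFamily (S : Set G) R (k * R) x := by
  classical
  obtain ⟨c, hc1, hc⟩ := hexp
  -- The factor 3 in place of 2 leaves room for a strict inequality after taking `R`-th powers.
  obtain ⟨k, hk⟩ := pow_unbounded_of_one_lt (3 * (S.card + 1) : ℝ) hc1
  refine ⟨k, fun R hR => ?_⟩
  obtain ⟨B, hB, -⟩ := exists_finset_of_wordNorm_le S hS hgen (k * R)
  have hcard : c ^ (k * R) ≤ (B.card : ℝ) := by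
    have hset : {g : G | wordDist (S : Set G) 1 g ≤ k * R} = B := by
      ext g
      simp [wordDist, hB]
    have := hc (k * R)
    rwa [hset, Set.ncard_coe_finset] at this
  have hlt : 2 ^ R * (S.card + 1) ^ R < B.card := by
    have h : (2 * (S.card + 1) : ℝ) ^ R < B.card :=
      calc (2 * (S.card + 1) : ℝ) ^ R < (3 * (S.card + 1) : ℝ) ^ R := by
            apply pow_lt_pow_left₀ _ (by positivity) (by omega)
            have : (0 : ℝ) < S.card + 1 := by positivity
            linarith
        _ ≤ (c ^ k) ^ R := by gcongr
        _ = c ^ (k * R) := (pow_mul c k R).symm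
        _ ≤ B.card := hcard
    rw [mul_pow] at h
    exact_mod_cast h
  obtain ⟨Y, hYc, h1, hYB, hsep⟩ := exists_separated_finset S hS hgen B hlt
  have hcY : (Y.erase 1).card = 2 ^ R := by
    rw [Finset.card_erase_of_mem h1, hYc, Nat.add_sub_cancel]
  let e := (Y.erase 1).equivFinOfCardEq hcY
  have hmem : ∀ i, (e.symm i : G) ≠ 1 ∧ (e.symm i : G) ∈ Y :=
    fun i => Finset.mem_erase.1 (e.symm i).2
  refine ⟨fun i => e.symm i, ?_, ?_, ?_⟩
  · exact fun i => (hB _).1 ((hYB _ (hmem i).2).resolve_left (hmem i).1)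
  · intro i
    simpa using hsep _ (hmem i).2 1 h1 (hmem i).1
  · intro i j hij
    refine hsep _ (hmem i).2 _ (hmem j).2 fun h => hij ?_
    exact e.symm.injective (Subtype.ext h)

/-! ### Placing a cube in the wreath product and reading it off -/

theorem WreathProduct.left_mul {G A : Type*} [Group G] [AddCommGroup A] (a b : WreathProduct A G) :
    (a * b).left.toAdd = a.left.toAdd + rightTranslate a.right b.left.toAdd := rfl

theorem WreathProduct.left_inv {G A : Type*} [Group G] [AddCommGroup A] (a : WreathProduct A G) :
    (a⁻¹).left.toAdd = -rightTranslate a.right⁻¹ a.left.toAdd := by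
  rw [SemidirectProduct.inv_left, map_inv]
  rfl

theorem rightTranslate_single {H A : Type*} [Group H] [AddCommGroup A] (h x : H) (a : A) :
    rightTranslate h (Finsupp.single x a) = Finsupp.single (x * h⁻¹) a := by
  simp [rightTranslate, Finsupp.domCongr, Finsupp.equivMapDomain_single]

/-- The lamp configuration whose only lit lamp is at `y`, with value `1`. -/
noncomputable def lampAt {G : Type*} [Group G] (y : G) : WreathProduct (ZMod 6) G :=
  inl (Multiplicative.ofAdd (Finsupp.single y 1))

/-- The reduction `ℤ₆ → ℤ₂`. -/
noncomputable def modTwo : ZMod 6 →+* ZMod 2 := ZMod.castHom (by norm_num) (ZMod 2)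

section Cube

variable {G ι κ : Type*} [Group G] [Fintype κ]

/-- The linear map sending the basis vectors of the cube to the indicator functions of the points
`lampAt (x i)`. -/
noncomputable def cubeEmbedding [Fintype ι] (x : ι → G) : (ι → ZMod 2) →ₗ[ZMod 2]
    (WreathProduct (ZMod 6) G →₀ ZMod 2) :=
  ∑ i, (Finsupp.lsingle (lampAt (x i))).comp (LinearMap.proj i)

theorem cubeEmbedding_apply [Fintype ι] (x : ι → G) (w : ι → ZMod 2) :
    cubeEmbedding x w = ∑ i, Finsupp.single (lampAt (x i)) (w i) := by
  simp [cubeEmbedding]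

open Classical in
/-- The parities of the lamps of `h` at the sites `x i` if the `G`-component of `h` is trivial,
and zero otherwise. -/
noncomputable def lampParity (x : ι → G) (h : WreathProduct (ZMod 6) G) : ι → ZMod 2 :=
  if h.right = 1 then fun i => modTwo (h.left.toAdd (x i)) else 0

/-- The linear extension of `lampParity`. -/
noncomputable def readout (x : ι → G) : (WreathProduct (ZMod 6) G →₀ ZMod 2) →ₗ[ZMod 2]
    (ι → ZMod 2) :=
  Finsupp.linearCombination (ZMod 2) (lampParity x)

theorem readout_single (x : ι → G) (h : WreathProduct (ZMod 6) G) (a : ZMod 2) :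
    readout x (Finsupp.single h a) = a • lampParity x h :=
  Finsupp.linearCombination_single _ _ _

theorem readout_rightTranslate_cubeEmbedding (x : ι → G) (y : κ → G) (w : κ → ZMod 2)
    (h : WreathProduct (ZMod 6) G) :
    readout x (rightTranslate h (cubeEmbedding y w)) =
      ∑ j, w j • lampParity x (lampAt (y j) * h⁻¹) := by
  simp only [cubeEmbedding_apply, map_sum, rightTranslate_single, readout_single]

theorem lampParity_lampAt_mul [DecidableEq G] (x : ι → G) (y : G) (k : WreathProduct (ZMod 6) G)
    (hk : k.right = 1) :
    lampParity x (lampAt y * k) = lampParity x k + fun i => if y = x i then 1 else 0 := by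
  have hr : (lampAt y * k).right = 1 := by simp [lampAt, hk]
  ext i
  rw [lampParity, if_pos hr, Pi.add_apply, lampParity, if_pos hk, WreathProduct.left_mul]
  simp only [lampAt, right_inl, left_inl, toAdd_ofAdd, rightTranslate_one, Finsupp.add_apply, map_add,
    Finsupp.single_apply, apply_ite modTwo, map_one, map_zero]
  rw [add_comm]

theorem lampParity_of_right_ne_one (x : ι → G) {k : WreathProduct (ZMod 6) G} (hk : k.right ≠ 1) :
    lampParity x k = 0 := if_neg hk

/-- When `h` has trivial `G`-component, each term is the parity vector of `h⁻¹` plus the indicator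
of one site. The common offset is multiplied by `∑ j, w j = 0` and disappears. Otherwise every
translated point has nontrivial `G`-component and reads out as zero. -/
theorem readout_rightTranslate_of_sum_eq_zero [DecidableEq G] (x : ι → G) (y : κ → G)
    {w : κ → ZMod 2} (hw : ∑ j, w j = 0) (h : WreathProduct (ZMod 6) G) :
    readout x (rightTranslate h (cubeEmbedding y w)) = 0 ∨
    readout x (rightTranslate h (cubeEmbedding y w)) =
      ∑ j, w j • fun i => if y j = x i then 1 else 0 := by
  rw [readout_rightTranslate_cubeEmbedding]
  by_cases hh : h.right = 1
  · right
    have hk : (h⁻¹).right = 1 := by simp [hh]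
    simp only [lampParity_lampAt_mul _ _ _ hk, smul_add, Finset.sum_add_distrib, ← Finset.sum_smul,
      hw, zero_smul, zero_add]
  · left
    refine Finset.sum_eq_zero fun j _ => ?_
    rw [lampParity_of_right_ne_one, smul_zero]
    simpa [lampAt] using hh

theorem sum_smul_indicator_self {G ι : Type*} [Fintype ι] [DecidableEq G] {x : ι → G} (hx : Function.Injective x)
    (w : ι → ZMod 2) : (∑ j, w j • fun i => if x j = x i then (1 : ZMod 2) else 0) = w := by
  classical
  ext i
  simp [Finset.sum_apply, hx.eq_iff]

/-- Without translation the offset is the parity vector of the identity, which is zero, so no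
condition on the coordinate sum is needed. -/
theorem readout_cubeEmbedding [Fintype ι] {x : ι → G} (hx : Function.Injective x) (w : ι → ZMod 2) :
    readout x (cubeEmbedding x w) = w := by
  classical
  have h1 : lampParity x (1 : WreathProduct (ZMod 6) G) = 0 := by
    ext i
    simp [lampParity]
  have h := readout_rightTranslate_cubeEmbedding x x w 1
  rw [rightTranslate_one, inv_one] at h
  simp only [lampParity_lampAt_mul x _ (1 : WreathProduct (ZMod 6) G) rfl, h1, zero_add] at h
  rw [h, sum_smul_indicator_self hx]

end Cube

theorem sum_eq_zero_of_mem_dualCode {d : ℕ} {C : Submodule (ZMod 2) (Fin d → ZMod 2)}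
    (hC : (fun _ => 1) ∈ C) {w : Fin d → ZMod 2} (hw : w ∈ dualCode C) : ∑ i, w i = 0 := by
  simpa using hw _ hC

/-! ### The invariant space of relations and its readout -/

section Relations

variable {G : Type*} [Group G] {d : ℕ → ℕ}

/-- The right-translation-invariant subspace generated by the images of the subspaces `W n`. -/
noncomputable def translateSpan (x : ∀ n, Fin (d n) → G) (W : ∀ n, Submodule (ZMod 2) (Fin (d n) → ZMod 2)) :
    Submodule (ZMod 2) (WreathProduct (ZMod 6) G →₀ ZMod 2) :=
  Submodule.span (ZMod 2)
    {f | ∃ h n, ∃ w ∈ W n, f = rightTranslate h (cubeEmbedding (x n) w)}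

theorem isTranslationInvariant_translateSpan (x : ∀ n, Fin (d n) → G)
    (W : ∀ n, Submodule (ZMod 2) (Fin (d n) → ZMod 2)) :
    IsTranslationInvariant (translateSpan x W) := by
  intro h f hf
  induction hf using Submodule.span_induction with
  | mem f hf =>
    obtain ⟨k, n, w, hw, rfl⟩ := hf
    exact Submodule.subset_span ⟨h * k, n, w, hw, (rightTranslate_mul h k _).symm⟩
  | zero => simp
  | add f g _ _ hf hg => simpa using add_mem hf hg
  | smul a f _ hf =>
    have : rightTranslate h (a • f) = a • rightTranslate h f := by
      ext y
      simp [rightTranslate_apply]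
    rw [this]
    exact Submodule.smul_mem _ a hf

theorem cubeEmbedding_mem_translateSpan (x : ∀ n, Fin (d n) → G)
    (W : ∀ n, Submodule (ZMod 2) (Fin (d n) → ZMod 2)) (n : ℕ) {w : Fin (d n) → ZMod 2}
    (hw : w ∈ W n) : cubeEmbedding (x n) w ∈ translateSpan x W :=
  Submodule.subset_span ⟨1, n, w, hw, (rightTranslate_one _).symm⟩

/-- It suffices to look at translated generators. Those of scale `n` read out as zero or as an
element of `W n`; those of another scale read out as zero because they share no site with scale `n`.
-/
theorem readout_mem_of_mem_translateSpan {x : ∀ n, Fin (d n) → G}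
    (hinj : ∀ n, Function.Injective (x n)) (hdisj : ∀ m n, m ≠ n → ∀ i j, x m i ≠ x n j)
    {W : ∀ n, Submodule (ZMod 2) (Fin (d n) → ZMod 2)}
    (hW : ∀ n, ∀ w ∈ W n, ∑ i, w i = 0) (n : ℕ) {f : WreathProduct (ZMod 6) G →₀ ZMod 2}
    (hf : f ∈ translateSpan x W) : readout (x n) f ∈ W n := by
  classical
  refine (Submodule.span_le (p := (W n).comap (readout (x n)))).2 ?_ hf
  rintro _ ⟨h, m, w, hw, rfl⟩
  show readout (x n) _ ∈ W n
  rcases readout_rightTranslate_of_sum_eq_zero (x n) (x m) (hW m w hw) h with h0 | h1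
  · rw [h0]
    exact zero_mem _
  · rw [h1]
    by_cases hmn : m = n
    · subst hmn
      rwa [sum_smul_indicator_self (hinj m)]
    · have : (∑ j, w j • fun i => if x m j = x n i then (1 : ZMod 2) else 0) = 0 := by
        ext i
        simp [Finset.sum_apply, hdisj m n hmn]
      rw [this]
      exact zero_mem _

end Relations

/-! ### Word lengths over the zero section -/

section Tours

variable {G : Type*} [Group G] {S : Set G}

theorem zeroSection_add {H : Type*} [Group H] {V : Submodule (ZMod 2) (H →₀ ZMod 2)}
    (hV : IsTranslationInvariant V) (p q : (H →₀ ZMod 2) ⧸ V) :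
    zeroSection V hV (p + q) = zeroSection V hV p * zeroSection V hV q := by
  simp [zeroSection, ofAdd_add]

theorem zeroSection_zero {H : Type*} [Group H] {V : Submodule (ZMod 2) (H →₀ ZMod 2)}
    (hV : IsTranslationInvariant V) : zeroSection V hV 0 = 1 := by
  simp [zeroSection]

theorem zeroSection_neg {H : Type*} [Group H] {V : Submodule (ZMod 2) (H →₀ ZMod 2)}
    (hV : IsTranslationInvariant V) (p : (H →₀ ZMod 2) ⧸ V) :
    zeroSection V hV (-p) = (zeroSection V hV p)⁻¹ := by
  simp [zeroSection, ofAdd_neg]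

theorem zeroSection_mk_single {H : Type*} [Group H] {V : Submodule (ZMod 2) (H →₀ ZMod 2)}
    (hV : IsTranslationInvariant V) (y : H) :
    zeroSection V hV (Submodule.Quotient.mk (Finsupp.single y 1)) =
      inr y⁻¹ * zeroSection V hV (Submodule.Quotient.mk (Finsupp.single 1 1)) * inr y := by
  have h : quotTranslate V hV y⁻¹ (Submodule.Quotient.mk (Finsupp.single 1 1)) =
      Submodule.Quotient.mk (Finsupp.single y 1) := by
    rw [quotTranslate_mk, rightTranslate_single, inv_inv, one_mul]
  rw [← h]
  have := inl_aut (φ := quotLampAction V hV) y⁻¹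
    (Multiplicative.ofAdd (Submodule.Quotient.mk (Finsupp.single 1 1)))
  rw [inv_inv] at this
  exact this

theorem LampQuotient.left_mul {H : Type*} [Group H] {V : Submodule (ZMod 2) (H →₀ ZMod 2)}
    {hV : IsTranslationInvariant V} (a b : LampQuotient V hV) :
    (a * b).left.toAdd = a.left.toAdd + quotTranslate V hV a.right b.left.toAdd := rfl

theorem inv_mem_wreathGenerators (hS : ∀ s ∈ S, s⁻¹ ∈ S) :
    ∀ t ∈ wreathGenerators S, t⁻¹ ∈ wreathGenerators S := by
  rintro t ((rfl | rfl) | ⟨s, hs, rfl⟩)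
  · refine Or.inl (Or.inr ?_)
    rw [← map_inv, ← ofAdd_neg, ← Finsupp.single_neg]
    rfl
  · refine Or.inl (Or.inl ?_)
    rw [← map_inv, ← ofAdd_neg, ← Finsupp.single_neg, neg_neg]
  · exact Or.inr ⟨s⁻¹, hS s hs, map_inv _ _⟩

theorem isShortProduct_lampAt (hS : ∀ s ∈ S, s⁻¹ ∈ S) (hgen : Subgroup.closure S = ⊤) (y : G) :
    IsShortProduct (wreathGenerators S) (2 * wordNorm S y + 1) (lampAt y) := by
  have hy := (isShortProduct_wordNorm hS hgen y).map (T := wreathGenerators S)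
    (inr : G →* WreathProduct (ZMod 6) G) fun s hs => Or.inr ⟨s, hs, rfl⟩
  have h : lampAt y = (inr y)⁻¹ * inl (Multiplicative.ofAdd (Finsupp.single 1 1)) *
      (inr y : WreathProduct (ZMod 6) G) := by
    have := inl_aut (φ := lampAction (ZMod 6) G) y⁻¹ (Multiplicative.ofAdd (Finsupp.single 1 1))
    rw [inv_inv] at this
    rw [← map_inv, ← this, lampAt]
    congr 1
    show _ = Multiplicative.ofAdd (rightTranslate y⁻¹ (Finsupp.single 1 1))
    rw [rightTranslate_single, inv_inv, one_mul]
  rw [h]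
  refine (((hy.inv (inv_mem_wreathGenerators hS)).mul (.of_mem (Or.inl (Or.inl rfl)))).mul
    hy).mono ?_
  omega

theorem isShortProduct_zeroSection_single
    {V : Submodule (ZMod 2) (WreathProduct (ZMod 6) G →₀ ZMod 2)}
    (hV : IsTranslationInvariant V) (hS : ∀ s ∈ S, s⁻¹ ∈ S) {n : ℕ} {y : WreathProduct (ZMod 6) G}
    (hy : IsShortProduct (wreathGenerators S) n y) :
    IsShortProduct (lampQuotientGenerators V hV (wreathGenerators S)) (2 * n + 1)
      (zeroSection V hV (Submodule.Quotient.mk (Finsupp.single y 1))) := by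
  have hmap : ∀ {z}, IsShortProduct (wreathGenerators S) n z →
      IsShortProduct (lampQuotientGenerators V hV (wreathGenerators S)) n (inr z) :=
    fun h => h.map inr fun s hs => Or.inr ⟨s, hs, rfl⟩
  rw [zeroSection_mk_single]
  refine (((hmap (hy.inv (inv_mem_wreathGenerators hS))).mul (.of_mem (Or.inl rfl))).mul
    (hmap hy)).mono ?_
  omega

/-- Each nonzero coordinate is handled separately: walking to a site, lighting it and walking back
takes `2 * Q + 1` letters, and conjugating the basic indicator by this word takes `2 * (2 * Q + 1) +
1 = 4 * Q + 3`. -/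
theorem isShortProduct_zeroSection_cubeEmbedding {ι : Type*} [Fintype ι]
    {V : Submodule (ZMod 2) (WreathProduct (ZMod 6) G →₀ ZMod 2)}
    (hV : IsTranslationInvariant V) (hS : ∀ s ∈ S, s⁻¹ ∈ S) (hgen : Subgroup.closure S = ⊤)
    {x : ι → G} {Q : ℕ} (hx : ∀ i, wordNorm S (x i) ≤ Q) (u : ι → ZMod 2) :
    IsShortProduct (lampQuotientGenerators V hV (wreathGenerators S)) ((4 * Q + 3) * hammingNorm u)
      (zeroSection V hV (Submodule.Quotient.mk (cubeEmbedding x u))) := by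
  classical
  rw [cubeEmbedding_apply, hammingNorm]
  induction (Finset.univ : Finset ι) using Finset.induction_on with
  | empty => simpa [zeroSection_zero] using IsShortProduct.one 0
  | insert i s hi ih =>
    rw [Finset.sum_insert hi, Submodule.Quotient.mk_add, zeroSection_add, Finset.filter_insert]
    by_cases hu : u i = 0
    · simpa [hu, zeroSection_zero] using ih
    · have hu1 : u i = 1 := (by decide : ∀ a : ZMod 2, a ≠ 0 → a = 1) _ hu
      rw [if_pos hu, Finset.card_insert_of_notMem (by simp [hi]), hu1]
      refine ((isShortProduct_zeroSection_single hV hS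
        (isShortProduct_lampAt hS hgen (x i))).mul ih).mono ?_
      have := hx i
      rw [Nat.mul_succ (4 * Q + 3)]
      omega

/-- A word of length `n` over the generators evaluates to the class of a function whose readout is
supported on the set `A` of the sites `x i` visited along the way; the last of them is `a`. -/
theorem exists_readout_support {ι : Type*}
    {V : Submodule (ZMod 2) (WreathProduct (ZMod 6) G →₀ ZMod 2)}
    (hV : IsTranslationInvariant V) (hS : ∀ s ∈ S, s⁻¹ ∈ S) (hgen : Subgroup.closure S = ⊤)
    {x : ι → G} {R Q : ℕ} (hR : 1 ≤ R) (hx : IsSeparatedFamily S R Q x)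
    (l : List (LampQuotient V hV))
    (hl : ∀ s ∈ l, s ∈ lampQuotientGenerators V hV (wreathGenerators S)) :
    ∃ f : WreathProduct (ZMod 6) G →₀ ZMod 2, Submodule.Quotient.mk f = l.prod.left.toAdd ∧
    ∃ A : Finset ι, (∀ i, readout x f i ≠ 0 → i ∈ A) ∧
      (∀ i, modTwo (l.prod.right.left.toAdd (x i)) ≠ 0 → i ∈ A) ∧
      ∃ a : G, (a = 1 ∨ ∃ i ∈ A, a = x i) ∧
        R * A.card + wordNorm S (a * l.prod.right.right) ≤ l.length := by
  classical
  induction l using List.reverseRecOn with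
  | nil => exact ⟨0, rfl, ∅, by simp, by simp, 1, Or.inl rfl, by simp [wordNorm_one]⟩
  | append_singleton l s ih =>
    obtain ⟨f, hf, A, hfA, hlA, a, ha, hlen⟩ := ih fun s hs => hl s (by simp [hs])
    have hs := hl s (by simp)
    rw [List.prod_append, List.prod_singleton, List.length_append, List.length_singleton]
    set p := l.prod
    -- With `G`-component `g`, a lamp letter acts on the lamp at `g⁻¹`, so `wordNorm S (a * g)`
    -- measures how far the walk is from the last new site `a`. This surplus is what pays for the
    -- next site.
    have toggle : ∀ c : ZMod 6,
        s = inr (inl (Multiplicative.ofAdd (Finsupp.single 1 c)) : WreathProduct (ZMod 6) G) →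
        ∃ f : WreathProduct (ZMod 6) G →₀ ZMod 2, Submodule.Quotient.mk f = (p * s).left.toAdd ∧
        ∃ A : Finset ι, (∀ i, readout x f i ≠ 0 → i ∈ A) ∧
          (∀ i, modTwo ((p * s).right.left.toAdd (x i)) ≠ 0 → i ∈ A) ∧
          ∃ a : G, (a = 1 ∨ ∃ i ∈ A, a = x i) ∧
            R * A.card + wordNorm S (a * (p * s).right.right) ≤ l.length + 1 := by
      rintro c rfl
      refine ⟨f, by simpa using hf, ?_⟩
      have hright : (p * inr (inl (Multiplicative.ofAdd (Finsupp.single 1 c)) :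
          WreathProduct (ZMod 6) G)).right.right = p.right.right := by simp
      have hlamp : ∀ i, x i ≠ p.right.right⁻¹ →
          (p * inr (inl (Multiplicative.ofAdd (Finsupp.single 1 c)) :
            WreathProduct (ZMod 6) G)).right.left.toAdd (x i) = p.right.left.toAdd (x i) := by
        intro i hi
        rw [mul_right, right_inr, WreathProduct.left_mul, left_inl, toAdd_ofAdd,
          rightTranslate_single, one_mul, Finsupp.add_apply, Finsupp.single_eq_of_ne hi, add_zero]
      rw [hright]
      by_cases hnew : ∃ j, x j = p.right.right⁻¹ ∧ j ∉ A
      · obtain ⟨j, hj, hjA⟩ := hnew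
        -- A site outside `A` is at distance at least `R` from `a`, which is the identity or another
        -- site. The surplus drops to zero and pays for raising the cardinality of `A` by one.
        have hfar : R ≤ wordNorm S (a * p.right.right) := by
          rw [← inv_inv p.right.right, ← hj]
          rcases ha with rfl | ⟨i, hi, rfl⟩
          · rw [one_mul, wordNorm_inv hS hgen]
            exact hx.le_norm j
          · exact hx.le_dist i j fun h => hjA (h ▸ hi)
        refine ⟨insert j A, fun i hi => Finset.mem_insert_of_mem (hfA i hi), fun i hi => ?_, x j,
          Or.inr ⟨j, Finset.mem_insert_self _ _, rfl⟩, ?_⟩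
        · by_cases hij : x i = p.right.right⁻¹
          · rw [hx.injective hR (hij.trans hj.symm)]
            exact Finset.mem_insert_self _ _
          · rw [hlamp i hij] at hi
            exact Finset.mem_insert_of_mem (hlA i hi)
        · rw [Finset.card_insert_of_notMem hjA, hj, inv_mul_cancel, wordNorm_one, mul_add]
          omega
      · push Not at hnew
        refine ⟨A, hfA, fun i hi => ?_, a, ha, by omega⟩
        by_cases hij : x i = p.right.right⁻¹
        · exact hnew i hij
        · rw [hlamp i hij] at hi
          exact hlA i hi
    rcases hs with rfl | ⟨t, (rfl | rfl) | ⟨g, hg, rfl⟩, rfl⟩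
    -- The added indicator sits at `p.right⁻¹`. Its readout vanishes unless the `G`-component is
    -- trivial, and then it consists of the parities of the negated current lamps, already supported
    -- on `A`.
    · refine ⟨f + Finsupp.single p.right⁻¹ 1, ?_, A, fun i hi => ?_, ?_, a, ha, ?_⟩
      · rw [LampQuotient.left_mul, Submodule.Quotient.mk_add, hf]
        congr 1
        show _ = quotTranslate V hV p.right (Submodule.Quotient.mk (Finsupp.single 1 1))
        rw [quotTranslate_mk, rightTranslate_single, one_mul]
      · by_contra hiA
        apply hi
        rw [map_add, Pi.add_apply, not_ne_iff.1 (mt (hfA i) hiA), zero_add, readout_single, one_smul,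
          lampParity]
        split_ifs with h1
        · have h2 : p.right.right = 1 := by simpa using h1
          rw [WreathProduct.left_inv, h2, inv_one, rightTranslate_one]
          show modTwo (-p.right.left.toAdd (x i)) = 0
          rw [map_neg, not_ne_iff.1 (mt (hlA i) hiA), neg_zero]
        · rfl
      · simpa [zeroSection] using hlA
      · simp only [zeroSection, mul_right, right_inl, mul_one]
        omega
    · exact toggle 1 rfl
    · exact toggle (-1) rfl
    · refine ⟨f, by simpa using hf, A, hfA, fun i hi => hlA i ?_, a, ha, ?_⟩
      · simpa using hi
      · rw [mul_right, mul_right, right_inr, right_inr, ← mul_assoc]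
        have := wordNorm_mul_generator_le hS hgen (a * p.right.right) hg
        omega

/-- The required vector is the readout of the function traced by the word. That function differs
from `cubeEmbedding x u` by an element of `V`, so its readout differs from `u` by an element of `W`.
-/
theorem exists_representative_of_isShortProduct {ι : Type*} [Fintype ι]
    {V : Submodule (ZMod 2) (WreathProduct (ZMod 6) G →₀ ZMod 2)}
    (hV : IsTranslationInvariant V) (hS : ∀ s ∈ S, s⁻¹ ∈ S) (hgen : Subgroup.closure S = ⊤)
    {x : ι → G} {R Q : ℕ} (hR : 1 ≤ R) (hx : IsSeparatedFamily S R Q x)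
    {W : Submodule (ZMod 2) (ι → ZMod 2)} (hW : ∀ f ∈ V, readout x f ∈ W) {n : ℕ} {u : ι → ZMod 2}
    (hu : IsShortProduct (lampQuotientGenerators V hV (wreathGenerators S)) n
      (zeroSection V hV (Submodule.Quotient.mk (cubeEmbedding x u)))) :
    ∃ v : ι → ZMod 2, (Submodule.Quotient.mk v : (ι → ZMod 2) ⧸ W) = Submodule.Quotient.mk u ∧
      R * hammingNorm v ≤ n := by
  obtain ⟨l, hl, hlu, hln⟩ := hu
  obtain ⟨f, hf, A, hfA, -, a, -, hlen⟩ := exists_readout_support hV hS hgen hR hx l hl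
  refine ⟨readout x f, ?_, ?_⟩
  · rw [hlu] at hf
    have hmem := hW _ ((Submodule.Quotient.eq V).1 hf)
    rw [map_sub, readout_cubeEmbedding (hx.injective hR)] at hmem
    exact (Submodule.Quotient.eq W).2 hmem
  · have hcard : hammingNorm (readout x f) ≤ A.card :=
      Finset.card_le_card fun i hi => hfA i (Finset.mem_filter.1 hi).2
    have := Nat.mul_le_mul_left R hcard
    omega

end Tours

/-! ### The quotient Hamming metric -/

theorem hammingQuotDist_le_hammingNorm {d : ℕ} (W : Submodule (ZMod 2) (Fin d → ZMod 2))
    (u v : Fin d → ZMod 2) :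
    hammingQuotDist W (Submodule.Quotient.mk u) (Submodule.Quotient.mk (u + v)) ≤ hammingNorm v :=
  Nat.sInf_le ⟨u, u + v, rfl, rfl, by rw [hammingDist_eq_hammingNorm, neg_add_cancel_left]⟩

theorem exists_hammingNorm_eq_hammingQuotDist {d : ℕ} (W : Submodule (ZMod 2) (Fin d → ZMod 2))
    (P Q : (Fin d → ZMod 2) ⧸ W) :
    ∃ u v : Fin d → ZMod 2, Submodule.Quotient.mk u = P ∧ Submodule.Quotient.mk (u + v) = Q ∧
      hammingNorm v = hammingQuotDist W P Q := by
  obtain ⟨p, hp⟩ := Submodule.Quotient.mk_surjective W P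
  obtain ⟨q, hq⟩ := Submodule.Quotient.mk_surjective W Q
  obtain ⟨x, y, hx, hy, hxy⟩ := Nat.sInf_mem (s := {k : ℕ | ∃ x y : Fin d → ZMod 2,
    Submodule.Quotient.mk x = P ∧ Submodule.Quotient.mk y = Q ∧ hammingDist x y = k})
    ⟨_, p, q, hp, hq, rfl⟩
  exact ⟨x, -x + y, hx, by rw [add_neg_cancel_left, hy],
    by rw [← hammingDist_eq_hammingNorm, hxy]; rfl⟩

theorem eq_of_hammingQuotDist_eq_zero {d : ℕ} {W : Submodule (ZMod 2) (Fin d → ZMod 2)}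
    {P Q : (Fin d → ZMod 2) ⧸ W} (h : hammingQuotDist W P Q = 0) : P = Q := by
  obtain ⟨u, v, rfl, rfl, hv⟩ := exists_hammingNorm_eq_hammingQuotDist W P Q
  rw [hammingNorm_eq_zero.1 (hv.trans h), add_zero]

/-- The distances between the images in the zero section of two points of a cube quotient. -/
theorem wordDist_zeroSection_mapQ {G : Type*} [Group G] {S : Set G} {d : ℕ}
    {V : Submodule (ZMod 2) (WreathProduct (ZMod 6) G →₀ ZMod 2)}
    (hV : IsTranslationInvariant V) (hS : ∀ s ∈ S, s⁻¹ ∈ S) (hgen : Subgroup.closure S = ⊤)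
    {x : Fin d → G} {R Q : ℕ} (hR : 1 ≤ R) (hx : IsSeparatedFamily S R Q x)
    {W : Submodule (ZMod 2) (Fin d → ZMod 2)} (hWV : W ≤ V.comap (cubeEmbedding x))
    (hVW : ∀ f ∈ V, readout x f ∈ W) (P P' : (Fin d → ZMod 2) ⧸ W) :
    R * hammingQuotDist W P P' ≤
      wordDist (lampQuotientGenerators V hV (wreathGenerators S))
        (zeroSection V hV (W.mapQ V (cubeEmbedding x) hWV P))
        (zeroSection V hV (W.mapQ V (cubeEmbedding x) hWV P')) ∧
    wordDist (lampQuotientGenerators V hV (wreathGenerators S))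
        (zeroSection V hV (W.mapQ V (cubeEmbedding x) hWV P))
        (zeroSection V hV (W.mapQ V (cubeEmbedding x) hWV P')) ≤
      (4 * Q + 3) * hammingQuotDist W P P' := by
  obtain ⟨u, v, rfl, rfl, huv⟩ := exists_hammingNorm_eq_hammingQuotDist W P P'
  have hdiff : (zeroSection V hV (W.mapQ V (cubeEmbedding x) hWV (Submodule.Quotient.mk u)))⁻¹ *
      zeroSection V hV (W.mapQ V (cubeEmbedding x) hWV (Submodule.Quotient.mk (u + v))) =
      zeroSection V hV (Submodule.Quotient.mk (cubeEmbedding x v)) := by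
    rw [← zeroSection_neg, ← zeroSection_add, ← map_neg, ← map_add, Submodule.Quotient.mk_add,
      neg_add_cancel_left, Submodule.mapQ_apply]
  have hup := isShortProduct_zeroSection_cubeEmbedding hV hS hgen hx.norm_le v
  rw [wordDist, hdiff, ← huv]
  refine ⟨?_, hup.wordNorm_le⟩
  -- The upper bound supplies an actual word, so the infimum defining the norm is attained and is
  -- not the default value 0 of an empty infimum.
  obtain ⟨w, hw, hlow⟩ :=
    exists_representative_of_isShortProduct hV hS hgen hR hx hVW hup.exists_wordNorm
  refine le_trans (Nat.mul_le_mul_left R ?_) hlow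
  rw [huv, Submodule.Quotient.mk_add, ← hw, ← Submodule.Quotient.mk_add]
  exact hammingQuotDist_le_hammingNorm W u w

/-- Any one pair bounds the infimum. If there is no pair, the real infimum takes the default value
0, which is where `0 ≤ c` enters. -/
theorem expansionRatio_le {X Z : Type*} {σ : X → X → ℝ} {θ : Z → Z → ℝ} {f : X → Z} {c : ℝ}
    (hc : 0 ≤ c) (hσ : ∀ u v, 0 ≤ σ u v) (hθ : ∀ u v, 0 ≤ θ u v)
    (h : ∀ u v, θ (f u) (f v) ≤ c * σ u v) : expansionRatio σ θ f ≤ c := by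
  rw [expansionRatio]
  rcases isEmpty_or_nonempty {p : X × X // p.1 ≠ p.2} with he | ⟨⟨p⟩⟩
  · rwa [Real.iInf_of_isEmpty]
  · refine (ciInf_le ⟨0, ?_⟩ p).trans (div_le_of_le_mul₀ (hσ _ _) hc (h _ _))
    rintro _ ⟨q, rfl⟩
    exact div_nonneg (hθ _ _) (hσ _ _)

/-! ### Choice of scales and assembly of the theorem -/

theorem theorem2 {G : Type*} [Group G] (S : Finset G)
    (hSinv : ∀ s ∈ S, s⁻¹ ∈ S) (hSgen : Subgroup.closure (S : Set G) = ⊤)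
    (hGam : IsAmenable G) (hGexp : HasExponentialGrowth (S : Set G))
    (C : ∀ d : ℕ, Submodule (ZMod 2) (Fin d → ZMod 2))
    (hC : ∀ d : ℕ, (fun _ => 1) ∈ C d) :
    ∃ M : ℝ, 1 ≤ M ∧
    ∃ (V : Submodule (ZMod 2) (WreathProduct (ZMod 6) G →₀ ZMod 2))
      (hV : IsTranslationInvariant V)
      (d : ℕ → ℕ)
      (φ : ∀ n : ℕ, (Fin (d n) → ZMod 2) ⧸ dualCode (C (d n)) →
        (WreathProduct (ZMod 6) G →₀ ZMod 2) ⧸ V),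
      (∀ n, 1 ≤ d n) ∧ StrictMono d ∧
      (∀ n, Function.Injective (φ n)) ∧
      (∀ n, IsBiLipschitz M
        (fun P Q => (hammingQuotDist (dualCode (C (d n))) P Q : ℝ))
        (fun x y => (wordDist (lampQuotientGenerators V hV (wreathGenerators (S : Set G))) x y : ℝ))
        (fun P => zeroSection V hV (φ n P))) ∧
      ∃ K : ℝ, 0 < K ∧ ∀ n, expansionRatio
        (fun P Q => (hammingQuotDist (dualCode (C (d n))) P Q : ℝ))
        (fun x y => (wordDist (lampQuotientGenerators V hV (wreathGenerators (S : Set G))) x y : ℝ))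
        (fun P => zeroSection V hV (φ n P)) ≤ K * Real.log (d n) := by
  obtain ⟨k, hk⟩ := exists_isSeparatedFamily S hSinv hSgen hGexp
  -- The ratio `k + 2` makes `k * R m < R (m + 1)`, so the annuli containing the sites of different
  -- scales are disjoint.
  let R : ℕ → ℕ := fun n => (k + 2) ^ n
  have hR : ∀ n, 1 ≤ R n := fun n => Nat.one_le_pow _ _ (by omega)
  have hRmono : StrictMono R := fun m n h => Nat.pow_lt_pow_right (by omega) h
  choose x hx using fun n => hk (R n) (hR n)
  have hfar : ∀ m n, m < n → ∀ i j, x m i ≠ x n j := by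
    intro m n hmn i j h
    have h1 := (hx m).norm_le i
    have h2 := (hx n).le_norm j
    rw [← h] at h2
    have h3 : R (m + 1) ≤ R n := hRmono.monotone hmn
    have h4 : R (m + 1) = (k + 2) * R m := pow_succ' _ _
    have h5 := hR m
    nlinarith
  have hdisj : ∀ m n, m ≠ n → ∀ i j, x m i ≠ x n j := fun m n hmn i j =>
    hmn.lt_or_gt.elim (fun h => hfar m n h i j) fun h => (hfar n m h j i).symm
  have hinj : ∀ n, Function.Injective (x n) := fun n => (hx n).injective (hR n)
  set W : ∀ n, Submodule (ZMod 2) (Fin (2 ^ R n) → ZMod 2) := fun n => dualCode (C (2 ^ R n))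
  set V := translateSpan x W
  have hV : IsTranslationInvariant V := isTranslationInvariant_translateSpan x W
  have hWV : ∀ n, W n ≤ V.comap (cubeEmbedding (x n)) :=
    fun n w hw => cubeEmbedding_mem_translateSpan x W n hw
  have hVW : ∀ n, ∀ f ∈ V, readout (x n) f ∈ W n := fun n f hf =>
    readout_mem_of_mem_translateSpan hinj hdisj
      (fun m w hw => sum_eq_zero_of_mem_dualCode (hC _) hw) n hf
  have hdist := fun n => wordDist_zeroSection_mapQ hV hSinv hSgen (hR n) (hx n) (hWV n) (hVW n)
  have hlower : ∀ n P P', (R n * hammingQuotDist (W n) P P' : ℝ) ≤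
      wordDist (lampQuotientGenerators V hV (wreathGenerators (S : Set G)))
      (zeroSection V hV ((W n).mapQ V (cubeEmbedding (x n)) (hWV n) P))
      (zeroSection V hV ((W n).mapQ V (cubeEmbedding (x n)) (hWV n) P')) := fun n P P' => by
    exact_mod_cast (hdist n P P').1
  have hupper : ∀ n P P', (wordDist (lampQuotientGenerators V hV (wreathGenerators (S : Set G)))
      (zeroSection V hV ((W n).mapQ V (cubeEmbedding (x n)) (hWV n) P))
      (zeroSection V hV ((W n).mapQ V (cubeEmbedding (x n)) (hWV n) P')) : ℝ) ≤
      (4 * k + 3) * R n * hammingQuotDist (W n) P P' := by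
    intro n P P'
    -- Since `R n ≥ 1`, the additive 3 is absorbed, so the distortion bound `4 * k + 3` does not
    -- depend on the scale.
    have hle : 4 * (k * R n) + 3 ≤ (4 * k + 3) * R n := by nlinarith [hR n]
    exact_mod_cast (hdist n P P').2.trans (Nat.mul_le_mul_right _ hle)
  refine ⟨4 * k + 3, by linarith [(Nat.cast_nonneg k : (0 : ℝ) ≤ k)], V, hV, fun n => 2 ^ R n,
    fun n => (W n).mapQ V (cubeEmbedding (x n)) (hWV n), fun n => Nat.one_le_two_pow,
    fun m n h => Nat.pow_lt_pow_right (by omega) (hRmono h), fun n P P' hPP => ?_, fun n => ?_,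
    (4 * k + 3) / Real.log 2, by positivity, fun n => ?_⟩
  -- Injectivity follows from the lower bound: equal images are at distance 0, and `R n` is
  -- positive.
  · have h := (hdist n P P').1
    rw [show (W n).mapQ V (cubeEmbedding (x n)) (hWV n) P = _ from hPP, wordDist, inv_mul_cancel, wordNorm_one] at h
    refine eq_of_hammingQuotDist_eq_zero ((Nat.mul_eq_zero.1 (Nat.le_zero.1 h)).resolve_left ?_)
    have := hR n
    omega
  · exact ⟨R n, by exact_mod_cast hR n, fun P P' =>
      ⟨hlower n P P', hupper n P P'⟩⟩
  · have hlog : (4 * k + 3) / Real.log 2 * Real.log ((2 ^ R n : ℕ) : ℝ) = (4 * k + 3) * R n := by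
      have : Real.log 2 ≠ 0 := (Real.log_pos one_lt_two).ne'
      rw [Nat.cast_pow, Real.log_pow, Nat.cast_ofNat]
      field_simp
    rw [hlog]
    exact expansionRatio_le (by positivity) (fun _ _ => Nat.cast_nonneg _)
      (fun _ _ => Nat.cast_nonneg _) (hupper n)
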